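/- Let $M$ be a connected smooth ($C^\infty$, Hausdorff, second countable) finite-dimensional manifold. A Finsler metric on $M$ is a continuous function $F\colon TM\to\mathbb{R}$ that is smooth on the complement of the zero section, satisfies $F(tv)=tF(v)$ for all $t>0$, and is such that at every nonzero $v\in T_pM$ the Hessian of $\frac12 F^2|_{T_pM}$ is positive definite. Let $F$ be a Randers metric, i.e. a Finsler metric of the form $F(v)=\sqrt{\alpha_p(v,v)}+\beta_p(v)$ ($v\in T_pM$), where $\alpha$ is a smooth Riemannian metric and $\beta$ is a smooth 1-form on $M$, and suppose that $F$ is non-Riemannian, i.e. $F$ is not of the form $v\mapsto\sqrt{g_p(v,v)}$ for any smooth Riemannian metric $g$ on $M$. Let $\beta^\sharp$ be the dual vector field of $\beta$, defined by $\alpha_p(\beta^\sharp_p,w)=\beta_p(w)$ for all $w\in T_pM$. Then $(M,F)$ is a generalized Berwald space, i.e. there is a smooth linear connection $\nabla$ on $M$ whose parallel transports along smooth curves preserve $F$ (for every smooth curve $c\colon[0,1]\to M$ and every $\nabla$-parallel vector field $X$ along $c$ one has $F(X(1))=F(X(0))$), if and only if $\beta^\sharp$ has positive constant length with respect to $\alpha$,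 i.e. there is a constant $K>0$ such that $\sqrt{\alpha_p(\beta^\sharp_p,\beta^\sharp_p)}=K$ for all $p\in M$. -/

import Mathlib

open Bundle Set
open scoped Manifold ContDiff

noncomputable section

namespace Randers

variable {E : Type*} [NormedAddCommGroup E] [NormedSpace ℝ E]
  {M : Type*} [TopologicalSpace M] [ChartedSpace E M]

/-! ### Finsler metrics -/

/-- A Finsler metric on `M`: a continuous function `F : TM → ℝ` that is smooth on the complement of
the zero section, positively homogeneous of degree one, and such that on every tangent space the
Hessian of the energy `F ^ 2 / 2` is positive definite at every nonzero vector. The Hessian is taken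
on the model space `E`, to which `TangentSpace 𝓘(ℝ, E) p` is equal as a topological vector space. -/
structure IsFinslerMetric [IsManifold 𝓘(ℝ, E) ∞ M] (F : TangentBundle 𝓘(ℝ, E) M → ℝ) : Prop where
  continuous : Continuous F
  smooth : ContMDiffOn 𝓘(ℝ, E).tangent 𝓘(ℝ, ℝ) ∞ F {v | v.snd ≠ 0}
  homogeneous : ∀ (p : M) (v : TangentSpace 𝓘(ℝ, E) p) (t : ℝ), 0 < t →
    F ⟨p, t • v⟩ = t * F ⟨p, v⟩
  strongly_convex : ∀ (p : M) (v w : E), v ≠ 0 → w ≠ 0 →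
    0 < iteratedFDeriv ℝ 2 (fun y : E ↦ F ⟨p, y⟩ ^ 2 / 2) v ![w, w]

/-- Smooth Riemannian metrics on `M`. -/
abbrev RMetric (E : Type*) [NormedAddCommGroup E] [NormedSpace ℝ E]
    (M : Type*) [TopologicalSpace M] [ChartedSpace E M] [IsManifold 𝓘(ℝ, E) ∞ M] :=
  ContMDiffRiemannianMetric 𝓘(ℝ, E) ∞ E (TangentSpace 𝓘(ℝ, E) : M → Type _)

/-- The length of a tangent vector with respect to a Riemannian metric. -/
def length [IsManifold 𝓘(ℝ, E) ∞ M] (g : RMetric E M) (p : M) (v : TangentSpace 𝓘(ℝ, E) p) : ℝ :=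
  √(g.inner p v v)

/-- `F` is Riemannian: it is the length function of some smooth Riemannian metric. -/
def IsRiemannian [IsManifold 𝓘(ℝ, E) ∞ M] (F : TangentBundle 𝓘(ℝ, E) M → ℝ) : Prop :=
  ∃ g : RMetric E M, ∀ (p : M) (v : TangentSpace 𝓘(ℝ, E) p), F ⟨p, v⟩ = length g p v

/-- A smooth 1-form on `M`. -/
def IsSmoothOneForm [IsManifold 𝓘(ℝ, E) ∞ M] (β : Π p : M, TangentSpace 𝓘(ℝ, E) p →L[ℝ] ℝ) : Prop :=
  ContMDiff 𝓘(ℝ, E) (𝓘(ℝ, E).prod 𝓘(ℝ, E →L[ℝ] ℝ)) ∞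
    (fun p ↦ (TotalSpace.mk' (E →L[ℝ] ℝ) p (β p) :
      TotalSpace (E →L[ℝ] ℝ) fun p : M ↦ TangentSpace 𝓘(ℝ, E) p →L[ℝ] ℝ))

/-- `F` is a Randers metric with Riemannian part `α` and perturbating term `β`. -/
structure IsRandersMetric [IsManifold 𝓘(ℝ, E) ∞ M] (F : TangentBundle 𝓘(ℝ, E) M → ℝ)
    (α : RMetric E M) (β : Π p : M, TangentSpace 𝓘(ℝ, E) p →L[ℝ] ℝ) : Prop where
  finsler : IsFinslerMetric F
  smooth_form : IsSmoothOneForm β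
  eq_add : ∀ (p : M) (v : TangentSpace 𝓘(ℝ, E) p), F ⟨p, v⟩ = length α p v + β p v

/-! ### The dual vector field of a 1-form -/

theorem exists_dual [FiniteDimensional ℝ E] [IsManifold 𝓘(ℝ, E) ∞ M] (g : RMetric E M)
    (β : Π p : M, TangentSpace 𝓘(ℝ, E) p →L[ℝ] ℝ) (p : M) :
    ∃ b : TangentSpace 𝓘(ℝ, E) p, ∀ w, g.inner p b w = β p w := by
  have : FiniteDimensional ℝ (TangentSpace 𝓘(ℝ, E) p) := inferInstanceAs (FiniteDimensional ℝ E)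
  let B : TangentSpace 𝓘(ℝ, E) p →ₗ[ℝ] Module.Dual ℝ (TangentSpace 𝓘(ℝ, E) p) :=
    { toFun := fun v ↦ (g.inner p v).toLinearMap
      map_add' := fun v w ↦ by ext; simp
      map_smul' := fun t v ↦ by ext; simp }
  have hB : Function.Injective B := by
    refine (injective_iff_map_eq_zero B).2 fun v hv ↦ ?_
    by_contra hne
    have h1 : g.inner p v v = 0 := LinearMap.congr_fun hv v
    exact (g.pos p v hne).ne' h1
  obtain ⟨b, hb⟩ := (LinearMap.injective_iff_surjective_of_finrank_eq_finrank
    (Subspace.dual_finrank_eq (K := ℝ) (V := TangentSpace 𝓘(ℝ, E) p)).symm).1 hB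
    (β p).toLinearMap
  exact ⟨b, fun w ↦ LinearMap.congr_fun hb w⟩

/-- The dual vector field `β^♯` of the 1-form `β`: `g (β^♯, w) = β w` for all `w`. -/
def sharp [FiniteDimensional ℝ E] [IsManifold 𝓘(ℝ, E) ∞ M] (g : RMetric E M)
    (β : Π p : M, TangentSpace 𝓘(ℝ, E) p →L[ℝ] ℝ) (p : M) : TangentSpace 𝓘(ℝ, E) p :=
  (exists_dual g β p).choose

theorem inner_sharp [FiniteDimensional ℝ E] [IsManifold 𝓘(ℝ, E) ∞ M] (g : RMetric E M)
    (β : Π p : M, TangentSpace 𝓘(ℝ, E) p →L[ℝ] ℝ) (p : M) (w : TangentSpace 𝓘(ℝ, E) p) :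
    g.inner p (sharp g β p) w = β p w :=
  (exists_dual g β p).choose_spec w

/-! ### Linear connections and parallel transport -/

/-- Linear connections on `M`, as covariant derivatives on the tangent bundle. -/
abbrev LinearConnection (E : Type*) [NormedAddCommGroup E] [NormedSpace ℝ E]
    (M : Type*) [TopologicalSpace M] [ChartedSpace E M] [IsManifold 𝓘(ℝ, E) ∞ M] :=
  CovariantDerivative 𝓘(ℝ, E) E (TangentSpace 𝓘(ℝ, E) : M → Type _)

/-- The components `y(v)` of a tangent vector `v` in the coordinates given by the chart at `x₀`. -/
def coord [IsManifold 𝓘(ℝ, E) ∞ M] (x₀ p : M) (v : TangentSpace 𝓘(ℝ, E) p) : E :=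
  (trivializationAt E (TangentSpace 𝓘(ℝ, E)) x₀ ⟨p, v⟩).2

/-- The vector field whose components in the coordinates given by the chart at `x₀` are constantly
`y` (it is zero outside the domain of the chart). -/
def coordField [IsManifold 𝓘(ℝ, E) ∞ M] (x₀ : M) (y : E) : Π p : M, TangentSpace 𝓘(ℝ, E) p :=
  fun p ↦ (trivializationAt E (TangentSpace 𝓘(ℝ, E)) x₀).symm p y

/-- The velocity of a curve `c : [0, 1] → M`. -/
def velocity (c : ℝ → M) (t : ℝ) : TangentSpace 𝓘(ℝ, E) (c t) :=
  mfderivWithin 𝓘(ℝ, ℝ) 𝓘(ℝ, E) c (Icc 0 1) t (1 : ℝ)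

/-- The vector field `X` along `c : [0, 1] → M` is parallel with respect to `cov`: in the
coordinates given by any chart, `(X ^ k)' = - (c ^ i)' X ^ j Γ_{ij} ^ k ∘ c` holds wherever `c` is in
the domain of the chart. For a fixed `t` the right-hand side is the component vector of
`-∇_{c'(t)} Y`, where `Y` is the field with the constant components `X ^ j (t)`, since
`∇_{∂_i} ∂_j = Γ_{ij} ^ k ∂_k`. -/
def IsParallelAlong [IsManifold 𝓘(ℝ, E) ∞ M] (cov : LinearConnection E M) (c : ℝ → M)
    (X : Π t : ℝ, TangentSpace 𝓘(ℝ, E) (c t)) : Prop :=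
  ∀ x₀ : M, ∀ t ∈ Icc (0 : ℝ) 1, c t ∈ (chartAt E x₀).source →
    HasDerivWithinAt (fun s ↦ coord x₀ (c s) (X s))
      (-coord x₀ (c t) (cov (coordField x₀ (coord x₀ (c t) (X t))) (c t) (velocity c t)))
      (Icc 0 1) t

/-- The parallel transport along the smooth curve `c : [0, 1] → M` takes `v` to `w`. -/
def IsParallelTransport [IsManifold 𝓘(ℝ, E) ∞ M] (cov : LinearConnection E M) (c : ℝ → M)
    (v : TangentSpace 𝓘(ℝ, E) (c 0)) (w : TangentSpace 𝓘(ℝ, E) (c 1)) : Prop :=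
  ∃ X : Π t : ℝ, TangentSpace 𝓘(ℝ, E) (c t), IsParallelAlong cov c X ∧ X 0 = v ∧ X 1 = w

/-- `cov` is compatible to `F`: its parallel transports preserve the Finslerian length. -/
def IsCompatible [IsManifold 𝓘(ℝ, E) ∞ M] (cov : LinearConnection E M)
    (F : TangentBundle 𝓘(ℝ, E) M → ℝ) : Prop :=
  ∀ c : ℝ → M, ContMDiffOn 𝓘(ℝ, ℝ) 𝓘(ℝ, E) ∞ c (Icc 0 1) →
    ∀ (v : TangentSpace 𝓘(ℝ, E) (c 0)) (w : TangentSpace 𝓘(ℝ, E) (c 1)),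
      IsParallelTransport cov c v w → F ⟨c 1, w⟩ = F ⟨c 0, v⟩

/-- `(M, F)` is a generalized Berwald space: there is a smooth linear connection compatible
to `F`. -/
def IsGeneralizedBerwald [IsManifold 𝓘(ℝ, E) ∞ M] (F : TangentBundle 𝓘(ℝ, E) M → ℝ) : Prop :=
  ∃ cov : LinearConnection E M,
    CovariantDerivative.ContMDiffCovariantDerivative cov ∞ ∧ IsCompatible cov F

end Randers

end

/-!
A compatible connection transports `b := β^♯` and `-b` with unchanged values of `F`, so both `√α`
and `β` keep their values on the transport `X` of `b` along a curve from `p` to `q`. By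
Cauchy–Schwarz, `α(b_p, b_p) = β X = α(b_q, X)` is at most `|b_q| |X| = |b_q| |b_p|`, that is
`|b_p| ≤ |b_q|`. Nearby points are joined in both directions by chart segments along which the
linear transport equation is solvable, so `|b|` is locally constant.

Conversely, let `|b|` be locally constant and let `D` be a metric connection, glued from metric
connections in charts. Where `b ≠ 0`, the metric connection
`∇_v Y = D_v Y + (α(D_v b, Y) b - α(b, Y) D_v b) / α(b, b)` satisfies `∇ b = 0`, because
`α(D_v b, b) = 0`. Parallel transport then preserves `α` and `α(b, ·) = β`, hence `F`.
-/

noncomputable section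

namespace Randers

open Filter Topology

/-! ### Sections of homomorphism bundles and derivatives of vector-valued functions -/

section HomBundle

variable {𝕜 : Type*} [NontriviallyNormedField 𝕜]
  {EB : Type*} [NormedAddCommGroup EB] [NormedSpace 𝕜 EB] {HB : Type*} [TopologicalSpace HB]
  {I : ModelWithCorners 𝕜 EB HB} {B : Type*} [TopologicalSpace B] [ChartedSpace HB B]
  {F₁ : Type*} [NormedAddCommGroup F₁] [NormedSpace 𝕜 F₁] {V₁ : B → Type*}
  [TopologicalSpace (TotalSpace F₁ V₁)] [∀ q, TopologicalSpace (V₁ q)]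
  [∀ q, AddCommGroup (V₁ q)] [∀ q, Module 𝕜 (V₁ q)] [FiberBundle F₁ V₁] [VectorBundle 𝕜 F₁ V₁]
  {F₂ : Type*} [NormedAddCommGroup F₂] [NormedSpace 𝕜 F₂] {V₂ : B → Type*}
  [TopologicalSpace (TotalSpace F₂ V₂)] [∀ q, TopologicalSpace (V₂ q)]
  [∀ q, AddCommGroup (V₂ q)] [∀ q, Module 𝕜 (V₂ q)] [∀ q, IsTopologicalAddGroup (V₂ q)]
  [∀ q, ContinuousSMul 𝕜 (V₂ q)] [FiberBundle F₂ V₂] [VectorBundle 𝕜 F₂ V₂]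

theorem contMDiffAt_hom_section_iff_inCoordinates {n : ℕ∞ω} [ContMDiffVectorBundle n F₁ V₁ I]
    [ContMDiffVectorBundle n F₂ V₂ I] {φ : Π q, V₁ q →L[𝕜] V₂ q} {b p : B}
    (h₁ : p ∈ (trivializationAt F₁ V₁ b).baseSet) (h₂ : p ∈ (trivializationAt F₂ V₂ b).baseSet) :
    ContMDiffAt I (I.prod 𝓘(𝕜, F₁ →L[𝕜] F₂)) n
        (fun q ↦ TotalSpace.mk' (F₁ →L[𝕜] F₂) (E := fun q ↦ V₁ q →L[𝕜] V₂ q) q (φ q)) p ↔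
      ContMDiffAt I 𝓘(𝕜, F₁ →L[𝕜] F₂) n
        (fun q ↦ ContinuousLinearMap.inCoordinates F₁ V₁ F₂ V₂ b q b q (φ q)) p :=
  (trivializationAt (F₁ →L[𝕜] F₂) (fun q ↦ V₁ q →L[𝕜] V₂ q) b).contMDiffAt_section_iff ⟨h₁, h₂⟩

end HomBundle

variable {E : Type*} [NormedAddCommGroup E] [NormedSpace ℝ E]
  {M : Type*} [TopologicalSpace M] [ChartedSpace E M]

section Derivatives

variable {G : Type*} [NormedAddCommGroup G] [NormedSpace ℝ G] {p : M}

theorem mvfderiv_congr {f g : M → G} (h : f =ᶠ[𝓝 p] g) : d% f p = d% g p := by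
  ext v
  simp only [mvfderiv, ContinuousLinearMap.comp_apply, h.mfderiv_eq (I := 𝓘(ℝ, E))]
  rfl

theorem mvfderiv_clm_apply {G' : Type*} [NormedAddCommGroup G'] [NormedSpace ℝ G']
    {B : M → G →L[ℝ] G'} {f : M → G} (hB : MDiffAt B p) (hf : MDiffAt f p)
    (v : TangentSpace 𝓘(ℝ, E) p) :
    d% (fun q ↦ B q (f q)) p v = d% B p v (f p) + B p (d% f p v) := by
  have hBf : HasMFDerivAt 𝓘(ℝ, E) 𝓘(ℝ, (G →L[ℝ] G') × G) (fun q ↦ (B q, f q)) p _ :=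
    ⟨hB.continuousAt.prodMk hf.continuousAt, hB.hasMFDerivAt.2.prodMk hf.hasMFDerivAt.2⟩
  have h := HasMFDerivAt.comp p (g := fun x : (G →L[ℝ] G') × G ↦ x.1 x.2)
    (isBoundedBilinearMap_apply.hasFDerivAt (B p, f p)).hasMFDerivAt hBf
  exact (DFunLike.congr_fun h.mfderiv v).trans (add_comm _ _)

theorem hasDerivWithinAt_comp_curve {f : M → G} {c : ℝ → M} {t : ℝ} (hf : MDiffAt f (c t))
    (hc : MDifferentiableWithinAt 𝓘(ℝ, ℝ) 𝓘(ℝ, E) c (Icc 0 1) t) :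
    HasDerivWithinAt (fun s ↦ f (c s)) (d% f (c t) (velocity c t)) (Icc 0 1) t := by
  have h : HasFDerivWithinAt (fun s ↦ f (c s)) ((d% f (c t)).comp
      (mfderivWithin 𝓘(ℝ, ℝ) 𝓘(ℝ, E) c (Icc 0 1) t) : ℝ →L[ℝ] G) (Icc 0 1) t :=
    hasMFDerivWithinAt_iff_hasFDerivWithinAt.1
      (hf.hasMFDerivAt.comp_hasMFDerivWithinAt t hc.hasMFDerivWithinAt)
  exact h.hasDerivWithinAt

theorem hasDerivWithinAt_clm_apply_comp_curve {G' : Type*} [NormedAddCommGroup G']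
    [NormedSpace ℝ G'] {B : M → G →L[ℝ] G'} {c : ℝ → M} {y : ℝ → G} {y' : G} {t : ℝ}
    (hB : MDiffAt B (c t)) (hc : MDifferentiableWithinAt 𝓘(ℝ, ℝ) 𝓘(ℝ, E) c (Icc 0 1) t)
    (hy : HasDerivWithinAt y y' (Icc 0 1) t) :
    HasDerivWithinAt (fun s ↦ B (c s) (y s))
      (d% (fun q ↦ B q (y t)) (c t) (velocity c t) + B (c t) y') (Icc 0 1) t := by
  rw [mvfderiv_clm_apply hB mdifferentiableAt_const, mvfderiv_const]
  simpa using (hasDerivWithinAt_comp_curve hB hc).clm_apply hy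

end Derivatives

theorem source_mem_nhds {E M : Type*} [TopologicalSpace E] [TopologicalSpace M]
    [ChartedSpace E M] {x₀ p : M} (hp : p ∈ (chartAt E x₀).source) :
    (chartAt E x₀).source ∈ 𝓝 p :=
  (chartAt E x₀).open_source.mem_nhds hp

theorem mem_of_mem_finsupport {ι : Type*} {ρ : SmoothPartitionOfUnity ι 𝓘(ℝ, E) M}
    {U : ι → Set M} (hρ : ρ.IsSubordinate U) {i : ι} {p : M} (hi : i ∈ ρ.finsupport p) : p ∈ U i :=
  hρ i (subset_tsupport _ ((ρ.mem_finsupport p).1 hi))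

/-! ### Coordinates of tangent vectors -/

variable [IsManifold 𝓘(ℝ, E) ∞ M] {x₀ p : M}

/-- The coordinates `coord x₀ p` of the chart at `x₀` as a continuous linear map; outside the domain
of the chart it is zero. -/
def coordL (x₀ p : M) : TangentSpace 𝓘(ℝ, E) p →L[ℝ] E :=
  (trivializationAt E (TangentSpace 𝓘(ℝ, E)) x₀).continuousLinearMapAt ℝ p

/-- The map `y ↦ coordField x₀ y p`, inverse to `coordL x₀ p` on the domain of the chart, as a
continuous linear map. -/
def coordSymmL (x₀ p : M) : E →L[ℝ] TangentSpace 𝓘(ℝ, E) p :=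
  (trivializationAt E (TangentSpace 𝓘(ℝ, E)) x₀).symmL ℝ p

theorem coordL_apply (hp : p ∈ (chartAt E x₀).source) (v : TangentSpace 𝓘(ℝ, E) p) :
    coordL x₀ p v = coord x₀ p v :=
  Trivialization.continuousLinearMapAt_apply_of_mem
    (e := trivializationAt E (TangentSpace 𝓘(ℝ, E)) x₀) (R := ℝ) hp v

theorem coordSymmL_apply (hp : p ∈ (chartAt E x₀).source) (y : E) :
    coordSymmL x₀ p y = coordField x₀ y p :=
  (trivializationAt E (TangentSpace 𝓘(ℝ, E)) x₀).symmL_apply (R := ℝ) hp y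

theorem coord_coordField (hp : p ∈ (chartAt E x₀).source) (y : E) :
    coord x₀ p (coordField x₀ y p) = y := by
  rw [← coordL_apply hp, ← coordSymmL_apply hp]
  exact Trivialization.continuousLinearMapAt_symmL _ hp y

theorem coordField_coord (hp : p ∈ (chartAt E x₀).source) (v : TangentSpace 𝓘(ℝ, E) p) :
    coordField x₀ (coord x₀ p v) p = v := by
  rw [← coordL_apply hp, ← coordSymmL_apply hp]
  exact Trivialization.symmL_continuousLinearMapAt _ hp v

theorem coord_injective (hp : p ∈ (chartAt E x₀).source) :
    Function.Injective (coord (E := E) x₀ p) :=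
  Function.LeftInverse.injective fun v ↦ coordField_coord hp v

theorem coord_add (hp : p ∈ (chartAt E x₀).source) (v w : TangentSpace 𝓘(ℝ, E) p) :
    coord x₀ p (v + w) = coord x₀ p v + coord x₀ p w := by
  simp only [← coordL_apply hp, map_add]

theorem coord_smul (hp : p ∈ (chartAt E x₀).source) (a : ℝ) (v : TangentSpace 𝓘(ℝ, E) p) :
    coord x₀ p (a • v) = a • coord x₀ p v := by
  simp only [← coordL_apply hp, map_smul]

theorem coord_neg (hp : p ∈ (chartAt E x₀).source) (v : TangentSpace 𝓘(ℝ, E) p) :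
    coord x₀ p (-v) = -coord x₀ p v := by
  simp only [← coordL_apply hp, map_neg]

theorem eventually_coord_coordField (hp : p ∈ (chartAt E x₀).source) (y : E) :
    (fun q : M ↦ coord x₀ q (coordField x₀ y q)) =ᶠ[𝓝 p] fun _ ↦ y := by
  filter_upwards [source_mem_nhds hp] with q hq using coord_coordField hq y

theorem contMDiffAt_section_iff_coord {σ : Π q : M, TangentSpace 𝓘(ℝ, E) q}
    (hp : p ∈ (chartAt E x₀).source) :
    CMDiffAt ∞ (T% σ) p ↔ CMDiffAt ∞ (fun q ↦ coord x₀ q (σ q)) p :=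
  (trivializationAt E (TangentSpace 𝓘(ℝ, E)) x₀).contMDiffAt_section_iff (s := σ) hp

theorem mdifferentiableAt_section_iff_coord {σ : Π q : M, TangentSpace 𝓘(ℝ, E) q}
    (hp : p ∈ (chartAt E x₀).source) :
    MDiffAt (T% σ) p ↔ MDiffAt (fun q ↦ coord x₀ q (σ q)) p :=
  (trivializationAt E (TangentSpace 𝓘(ℝ, E)) x₀).mdifferentiableAt_section_iff 𝓘(ℝ, E) σ hp

theorem contMDiffAt_coordField (hp : p ∈ (chartAt E x₀).source) (y : E) :
    CMDiffAt ∞ (T% (coordField x₀ y)) p :=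
  (contMDiffAt_section_iff_coord hp).2 <|
    contMDiffAt_const.congr_of_eventuallyEq (eventually_coord_coordField hp y)

theorem mdifferentiableAt_coordField (hp : p ∈ (chartAt E x₀).source) (y : E) :
    MDiffAt (T% (coordField x₀ y)) p :=
  (contMDiffAt_coordField hp y).mdifferentiableAt (by simp)

/-- A field `D` of endomorphisms of the tangent spaces is smooth at `p`. -/
abbrev IsSmoothEndAt (D : Π q : M, TangentSpace 𝓘(ℝ, E) q →L[ℝ] TangentSpace 𝓘(ℝ, E) q) (p : M) :
    Prop :=
  ContMDiffAt 𝓘(ℝ, E) (𝓘(ℝ, E).prod 𝓘(ℝ, E →L[ℝ] E)) ∞ (fun q ↦ TotalSpace.mk' (E →L[ℝ] E)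
    (E := fun q : M ↦ TangentSpace 𝓘(ℝ, E) q →L[ℝ] TangentSpace 𝓘(ℝ, E) q) q (D q)) p

theorem isSmoothEndAt_iff_coordL {D : Π q : M, TangentSpace 𝓘(ℝ, E) q →L[ℝ] TangentSpace 𝓘(ℝ, E) q}
    (hp : p ∈ (chartAt E x₀).source) :
    IsSmoothEndAt D p ↔ ContMDiffAt 𝓘(ℝ, E) 𝓘(ℝ, E →L[ℝ] E) ∞
      (fun q ↦ coordL x₀ q ∘L D q ∘L coordSymmL x₀ q) p :=
  contMDiffAt_hom_section_iff_inCoordinates hp hp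

/-- The field `φ` of continuous linear maps from the tangent spaces to a fixed space is smooth
at `p`. -/
abbrev IsSmoothFormAt {G : Type*} [NormedAddCommGroup G] [NormedSpace ℝ G]
    (φ : Π q : M, TangentSpace 𝓘(ℝ, E) q →L[ℝ] G) (p : M) : Prop :=
  ContMDiffAt 𝓘(ℝ, E) (𝓘(ℝ, E).prod 𝓘(ℝ, E →L[ℝ] G)) ∞ (fun q ↦ TotalSpace.mk' (E →L[ℝ] G)
    (E := fun q : M ↦ TangentSpace 𝓘(ℝ, E) q →L[ℝ] G) q (φ q)) p

section Forms

variable {G : Type*} [NormedAddCommGroup G] [NormedSpace ℝ G]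

theorem isSmoothFormAt_iff_comp_coordSymmL {φ : Π q : M, TangentSpace 𝓘(ℝ, E) q →L[ℝ] G}
    (hp : p ∈ (chartAt E x₀).source) :
    IsSmoothFormAt φ p ↔
      ContMDiffAt 𝓘(ℝ, E) 𝓘(ℝ, E →L[ℝ] G) ∞ (fun q ↦ φ q ∘L coordSymmL x₀ q) p := by
  refine (contMDiffAt_hom_section_iff_inCoordinates (V₂ := Trivial M G) hp (mem_univ p)).trans ?_
  have h : ∀ q, ContinuousLinearMap.inCoordinates E (TangentSpace 𝓘(ℝ, E) : M → Type _) G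
      (Trivial M G) x₀ q x₀ q (φ q) = φ q ∘L coordSymmL x₀ q := fun q ↦ by
    ext y; simp [ContinuousLinearMap.inCoordinates, coordSymmL]
  simp only [h]

theorem isSmoothFormAt_mvfderiv {f : M → G} (hf : CMDiffAt ∞ f p) : IsSmoothFormAt (d% f) p := by
  rw [isSmoothFormAt_iff_comp_coordSymmL (mem_chart_source E p)]
  refine (hf.mfderiv_const (m := ∞) le_rfl).congr_of_eventuallyEq (.of_forall fun q ↦ ?_)
  ext y
  simp [inTangentCoordinates, ContinuousLinearMap.inCoordinates, coordSymmL]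
  rfl

end Forms

/-! ### Connections in a chart -/

/-- The covariant derivative with Christoffel symbols `Γ` in the coordinates given by the chart at
`x₀`: `(∇_v σ) ^ k = v (σ ^ k) + Γ_{ij} ^ k v ^ i σ ^ j`. The first argument of `Γ p` is the
direction of the derivative. -/
def chartConnection (x₀ : M) (Γ : M → E →L[ℝ] E →L[ℝ] E) (σ : Π p : M, TangentSpace 𝓘(ℝ, E) p)
    (p : M) : TangentSpace 𝓘(ℝ, E) p →L[ℝ] TangentSpace 𝓘(ℝ, E) p :=
  coordSymmL x₀ p ∘L
    (d% (fun q ↦ coord x₀ q (σ q)) p +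
      ContinuousLinearMap.apply ℝ E (coord x₀ p (σ p)) ∘L Γ p ∘L coordL x₀ p)

section ChartConnection

variable {Γ : M → E →L[ℝ] E →L[ℝ] E} {σ : Π q : M, TangentSpace 𝓘(ℝ, E) q}

theorem coord_chartConnection (hp : p ∈ (chartAt E x₀).source) (v : TangentSpace 𝓘(ℝ, E) p) :
    coord x₀ p (chartConnection x₀ Γ σ p v) =
      d% (fun q ↦ coord x₀ q (σ q)) p v + Γ p (coord x₀ p v) (coord x₀ p (σ p)) := by
  rw [chartConnection, ContinuousLinearMap.comp_apply, coordSymmL_apply hp, coord_coordField hp,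
    add_apply, ContinuousLinearMap.comp_apply, ContinuousLinearMap.comp_apply, coordL_apply hp]
  rfl

theorem isCovariantDerivativeOn_chartConnection (x₀ : M) (Γ : M → E →L[ℝ] E →L[ℝ] E) :
    IsCovariantDerivativeOn (I := 𝓘(ℝ, E)) E (chartConnection x₀ Γ) (chartAt E x₀).source where
  add {σ τ p} hσ hτ hp := by
    have h : (fun q ↦ coord x₀ q ((σ + τ) q)) =ᶠ[𝓝 p]
        (fun q ↦ coord x₀ q (σ q)) + fun q ↦ coord x₀ q (τ q) := by
      filter_upwards [source_mem_nhds hp] with q hq using coord_add hq _ _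
    ext v
    apply coord_injective hp
    rw [mdifferentiableAt_section_iff_coord hp] at hσ hτ
    rw [add_apply, coord_add hp, coord_chartConnection hp, coord_chartConnection hp,
      coord_chartConnection hp, mvfderiv_congr h, mvfderiv_add hσ hτ, Pi.add_apply, coord_add hp,
      map_add, add_apply]
    abel
  leibniz {σ g p} hσ hg hp := by
    have h : (fun q ↦ coord x₀ q ((g • σ) q)) =ᶠ[𝓝 p] g • fun q ↦ coord x₀ q (σ q) := by
      filter_upwards [source_mem_nhds hp] with q hq using coord_smul hq _ _
    ext v
    apply coord_injective hp
    rw [mdifferentiableAt_section_iff_coord hp] at hσ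
    rw [add_apply, coord_add hp, smul_apply, coord_smul hp, coord_chartConnection hp,
      coord_chartConnection hp, mvfderiv_congr h, mvfderiv_smul hg hσ, Pi.smul_apply',
      ContinuousLinearMap.smulRight_apply, coord_smul hp, coord_smul hp, map_smul, smul_add]
    simp only [add_apply, smul_apply, ContinuousLinearMap.smulRight_apply]
    abel

theorem isSmoothEndAt_chartConnection (hp : p ∈ (chartAt E x₀).source) (hΓ : CMDiffAt ∞ Γ p)
    (hσ : CMDiffAt ∞ (T% σ) p) : IsSmoothEndAt (chartConnection x₀ Γ σ) p := by
  rw [contMDiffAt_section_iff_coord hp] at hσ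
  have happly : CMDiffAt ∞ (fun q ↦ ContinuousLinearMap.apply ℝ E (coord x₀ q (σ q))) p :=
    (contMDiffAt_const
      (c := (ContinuousLinearMap.apply ℝ E : E →L[ℝ] (E →L[ℝ] E) →L[ℝ] E))).clm_apply hσ
  refine (isSmoothEndAt_iff_coordL hp).2 <| (((isSmoothFormAt_iff_comp_coordSymmL hp).1
    (isSmoothFormAt_mvfderiv hσ)).add (happly.clm_comp hΓ)).congr_of_eventuallyEq ?_
  filter_upwards [source_mem_nhds hp] with q hq
  ext y
  simp only [Pi.add_apply, add_apply, ContinuousLinearMap.comp_apply, coordL_apply hq,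
    coord_chartConnection hq, coordSymmL_apply hq, coord_coordField hq]
  rfl

end ChartConnection

/-- The Christoffel symbols `Γ_{ij} ^ k` of a connection in the chart at `x₀`: the difference of the
connection and the flat connection of the chart, in coordinates. As in `chartConnection`, the first
argument is the direction of the derivative. -/
def christoffel [FiniteDimensional ℝ E] (cov : LinearConnection E M) (x₀ p : M) :
    E →L[ℝ] E →L[ℝ] E :=
  ContinuousLinearMap.flip (E := E) (F := E) (G := E) <|
    (coordL x₀ p).postcomp E ∘L (coordSymmL x₀ p).precomp (TangentSpace 𝓘(ℝ, E) p) ∘L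
      cov.isCovariantDerivativeOn.difference (isCovariantDerivativeOn_chartConnection x₀ 0) p ∘L
        coordSymmL x₀ p

section Christoffel

variable [FiniteDimensional ℝ E] (cov : LinearConnection E M)

theorem coord_cov (hp : p ∈ (chartAt E x₀).source) {σ : Π q : M, TangentSpace 𝓘(ℝ, E) q}
    (hσ : MDiffAt (T% σ) p) (v : TangentSpace 𝓘(ℝ, E) p) :
    coord x₀ p (cov σ p v) = d% (fun q ↦ coord x₀ q (σ q)) p v +
      christoffel cov x₀ p (coord x₀ p v) (coord x₀ p (σ p)) := by
  have h : christoffel cov x₀ p (coord x₀ p v) (coord x₀ p (σ p)) =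
      coordL x₀ p (cov.isCovariantDerivativeOn.difference
        (isCovariantDerivativeOn_chartConnection x₀ 0) p (coordSymmL x₀ p (coord x₀ p (σ p)))
        (coordSymmL x₀ p (coord x₀ p v))) := rfl
  rw [h, coordSymmL_apply hp, coordSymmL_apply hp, coordField_coord hp, coordField_coord hp,
    IsCovariantDerivativeOn.difference_apply _ _ hp hσ, sub_apply, map_sub, coordL_apply hp,
    coordL_apply hp, coord_chartConnection hp, Pi.zero_apply]
  simp

theorem coord_cov_coordField (hp : p ∈ (chartAt E x₀).source) (v : TangentSpace 𝓘(ℝ, E) p)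
    (y : E) : coord x₀ p (cov (coordField x₀ y) p v) = christoffel cov x₀ p (coord x₀ p v) y := by
  rw [coord_cov cov hp (mdifferentiableAt_coordField hp y),
    mvfderiv_congr (eventually_coord_coordField hp y), mvfderiv_const, coord_coordField hp,
    zero_apply, zero_add]

end Christoffel

/-! ### Riemannian metrics and metric connections -/

section Length

variable (α : RMetric E M)

theorem inner_self_nonneg (v : TangentSpace 𝓘(ℝ, E) p) : 0 ≤ α.inner p v v := by
  obtain rfl | hv := eq_or_ne v 0
  · simp
  · exact (α.pos p v hv).le

theorem sq_length (v : TangentSpace 𝓘(ℝ, E) p) : length α p v ^ 2 = α.inner p v v :=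
  Real.sq_sqrt (inner_self_nonneg α v)

theorem length_neg (v : TangentSpace 𝓘(ℝ, E) p) : length α p (-v) = length α p v := by
  simp [length]

theorem inner_le_length_mul_length (v w : TangentSpace 𝓘(ℝ, E) p) :
    α.inner p v w ≤ length α p v * length α p w := by
  have h := LinearMap.BilinForm.apply_sq_le_of_symm (α.inner p).toBilinForm
    (inner_self_nonneg α) ⟨α.symm p⟩ v w
  rw [length, length, ← Real.sqrt_mul (inner_self_nonneg α v)]
  exact Real.le_sqrt_of_sq_le h

end Length

/-- The coordinate expression of a Riemannian metric in the chart at `x₀`. -/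
def metricCoord (α : RMetric E M) (x₀ p : M) : E →L[ℝ] E →L[ℝ] ℝ :=
  ContinuousLinearMap.inCoordinates E (TangentSpace 𝓘(ℝ, E)) (E →L[ℝ] ℝ)
    (fun p : M ↦ TangentSpace 𝓘(ℝ, E) p →L[ℝ] ℝ) x₀ p x₀ p (α.inner p)

section Metric

variable (α : RMetric E M)

theorem metricCoord_apply (hp : p ∈ (chartAt E x₀).source) (y z : E) :
    metricCoord α x₀ p y z = α.inner p (coordField x₀ y p) (coordField x₀ z p) := by
  rw [metricCoord, inCoordinates_apply_eq₂ (E₃ := Trivial M ℝ) hp hp (mem_univ _)]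
  simp [coordField]

theorem metricCoord_coord_coord (hp : p ∈ (chartAt E x₀).source) (v w : TangentSpace 𝓘(ℝ, E) p) :
    metricCoord α x₀ p (coord x₀ p v) (coord x₀ p w) = α.inner p v w := by
  rw [metricCoord_apply α hp, coordField_coord hp, coordField_coord hp]

theorem metricCoord_comm (hp : p ∈ (chartAt E x₀).source) (y z : E) :
    metricCoord α x₀ p y z = metricCoord α x₀ p z y := by
  rw [metricCoord_apply α hp, metricCoord_apply α hp, α.symm]

theorem contMDiffAt_metricCoord (hp : p ∈ (chartAt E x₀).source) :
    CMDiffAt ∞ (metricCoord α x₀) p :=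
  (contMDiffAt_hom_section_iff_inCoordinates (V₁ := (TangentSpace 𝓘(ℝ, E) : M → Type _))
    (V₂ := fun q : M ↦ TangentSpace 𝓘(ℝ, E) q →L[ℝ] ℝ) hp
      (by rw [hom_trivializationAt_baseSet]; exact ⟨hp, mem_univ _⟩)).1 (α.contMDiff p)

theorem mdifferentiableAt_metricCoord (hp : p ∈ (chartAt E x₀).source) :
    MDiffAt (metricCoord α x₀) p :=
  (contMDiffAt_metricCoord α hp).mdifferentiableAt (by simp)

theorem isInvertible_metricCoord [FiniteDimensional ℝ E] (hp : p ∈ (chartAt E x₀).source) :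
    (metricCoord α x₀ p).IsInvertible := by
  have hinj : Function.Injective (metricCoord α x₀ p : E →ₗ[ℝ] E →L[ℝ] ℝ) := by
    refine (injective_iff_map_eq_zero _).2 fun y hy ↦ by_contra fun hne ↦ ?_
    have hy0 : metricCoord α x₀ p y y = 0 := DFunLike.congr_fun hy y
    rw [metricCoord_apply α hp] at hy0
    refine (α.pos p (coordField x₀ y p) fun h0 ↦ hne ?_).ne' hy0
    rw [← coord_coordField hp y, h0, ← coordL_apply hp, map_zero]
  have hdim : Module.finrank ℝ E = Module.finrank ℝ (E →L[ℝ] ℝ) := by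
    rw [← (LinearMap.toContinuousLinearMap (𝕜 := ℝ) (E := E) (F' := ℝ)).finrank_eq]
    exact Subspace.dual_finrank_eq.symm
  exact ⟨(LinearEquiv.ofInjectiveOfFinrankEq _ hinj hdim).toContinuousLinearEquiv, by ext; rfl⟩

variable {Y Z : Π q : M, TangentSpace 𝓘(ℝ, E) q}

theorem eventually_inner_eq_metricCoord (hp : p ∈ (chartAt E x₀).source) :
    (fun q ↦ α.inner q (Y q) (Z q)) =ᶠ[𝓝 p]
      fun q ↦ metricCoord α x₀ q (coord x₀ q (Y q)) (coord x₀ q (Z q)) := by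
  filter_upwards [source_mem_nhds hp] with q hq using (metricCoord_coord_coord α hq _ _).symm

theorem mvfderiv_inner (hp : p ∈ (chartAt E x₀).source) (hY : MDiffAt (T% Y) p)
    (hZ : MDiffAt (T% Z) p) (v : TangentSpace 𝓘(ℝ, E) p) :
    d% (fun q ↦ α.inner q (Y q) (Z q)) p v =
      d% (metricCoord α x₀) p v (coord x₀ p (Y p)) (coord x₀ p (Z p)) +
        metricCoord α x₀ p (d% (fun q ↦ coord x₀ q (Y q)) p v) (coord x₀ p (Z p)) +
        metricCoord α x₀ p (coord x₀ p (Y p)) (d% (fun q ↦ coord x₀ q (Z q)) p v) := by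
  have hG := mdifferentiableAt_metricCoord α hp
  rw [mdifferentiableAt_section_iff_coord hp] at hY hZ
  rw [mvfderiv_congr (eventually_inner_eq_metricCoord α hp),
    mvfderiv_clm_apply (hG.clm_apply hY) hZ, mvfderiv_clm_apply hG hY, add_apply]

theorem mvfderiv_metricCoord_comm (hp : p ∈ (chartAt E x₀).source) (v : TangentSpace 𝓘(ℝ, E) p)
    (y z : E) : d% (metricCoord α x₀) p v y z = d% (metricCoord α x₀) p v z y := by
  have h : ∀ y z : E, d% (fun q ↦ metricCoord α x₀ q y z) p v = d% (metricCoord α x₀) p v y z := by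
    intro y z
    have hG := mdifferentiableAt_metricCoord α hp
    rw [mvfderiv_clm_apply (hG.clm_apply mdifferentiableAt_const) mdifferentiableAt_const,
      mvfderiv_clm_apply hG mdifferentiableAt_const, mvfderiv_const, mvfderiv_const]
    simp
  rw [← h, ← h, mvfderiv_congr]
  filter_upwards [source_mem_nhds hp] with q hq using metricCoord_comm α hq y z

/-- The Christoffel symbols `Γ_{ij} ^ k = g ^ {kl} ∂_i g_{jl} / 2` of a (not torsion-free) metric
connection in the chart at `x₀`. -/
def metricChristoffel (x₀ p : M) : E →L[ℝ] E →L[ℝ] E :=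
  ((1 / 2 : ℝ) • (metricCoord α x₀ p).inverse).postcomp E ∘L
    d% (metricCoord α x₀) p ∘L coordSymmL x₀ p

variable [FiniteDimensional ℝ E]

theorem metricCoord_metricChristoffel (hp : p ∈ (chartAt E x₀).source)
    (v : TangentSpace 𝓘(ℝ, E) p) (y z : E) :
    metricCoord α x₀ p (metricChristoffel α x₀ p (coord x₀ p v) y) z =
      d% (metricCoord α x₀) p v y z / 2 := by
  have h : metricCoord α x₀ p (metricChristoffel α x₀ p (coord x₀ p v) y) =
      (1 / 2 : ℝ) • d% (metricCoord α x₀) p v y := by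
    simp only [metricChristoffel, smul_apply, ContinuousLinearMap.comp_apply, map_smul,
      ContinuousLinearMap.postcomp_apply, coordSymmL_apply hp, coordField_coord hp,
      (isInvertible_metricCoord α hp).self_apply_inverse]
  rw [h, smul_apply, smul_eq_mul]
  ring

theorem contMDiffAt_metricChristoffel (hp : p ∈ (chartAt E x₀).source) :
    CMDiffAt ∞ (metricChristoffel α x₀) p := by
  have hG := contMDiffAt_metricCoord α hp
  have hinv : CMDiffAt ∞ (fun q ↦ (1 / 2 : ℝ) • (metricCoord α x₀ q).inverse) p :=
    ((contDiff_const_smul (1 / 2 : ℝ)).contDiffAt.comp _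
      (isInvertible_metricCoord α hp).contDiffAt_map_inverse).contMDiffAt.comp p hG
  exact hinv.clm_postcomp.clm_comp
    ((isSmoothFormAt_iff_comp_coordSymmL hp).1 (isSmoothFormAt_mvfderiv hG))

/-- The covariant derivative `D` is compatible with the Riemannian metric `α` on `s`: the product
rule `d(α(Y, Z)) = α(DY, Z) + α(Y, DZ)` holds there. -/
def IsMetricOn (D : (Π q : M, TangentSpace 𝓘(ℝ, E) q) →
      Π q : M, TangentSpace 𝓘(ℝ, E) q →L[ℝ] TangentSpace 𝓘(ℝ, E) q) (s : Set M) : Prop :=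
  ∀ p ∈ s, ∀ Y Z : Π q : M, TangentSpace 𝓘(ℝ, E) q, MDiffAt (T% Y) p → MDiffAt (T% Z) p → ∀ v,
    d% (fun q ↦ α.inner q (Y q) (Z q)) p v = α.inner p (D Y p v) (Z p) + α.inner p (Y p) (D Z p v)

theorem isMetricOn_chartConnection (x₀ : M) :
    IsMetricOn α (chartConnection x₀ (metricChristoffel α x₀)) (chartAt E x₀).source := by
  intro p hp Y Z hY hZ v
  rw [mvfderiv_inner α hp hY hZ, ← metricCoord_coord_coord α hp, ← metricCoord_coord_coord α hp,
    coord_chartConnection hp, coord_chartConnection hp, map_add, map_add, add_apply,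
    metricCoord_metricChristoffel α hp, metricCoord_comm α hp (coord x₀ p (Y p))
    (metricChristoffel α x₀ p _ _), metricCoord_metricChristoffel α hp,
    mvfderiv_metricCoord_comm α hp v (coord x₀ p (Z p))]
  ring

end Metric

/-! ### Gluing connections by a partition of unity -/

section Glue

variable {ι : Type*} (ρ : SmoothPartitionOfUnity ι 𝓘(ℝ, E) M)
  (D : ι → (Π q : M, TangentSpace 𝓘(ℝ, E) q) →
    Π q : M, TangentSpace 𝓘(ℝ, E) q →L[ℝ] TangentSpace 𝓘(ℝ, E) q)

/-- The combination `∑ i, ρ i • D i` of covariant derivatives `D i`, each of which need only be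
meaningful on the support of `ρ i`. -/
def glue (σ : Π q : M, TangentSpace 𝓘(ℝ, E) q) (p : M) :
    TangentSpace 𝓘(ℝ, E) p →L[ℝ] TangentSpace 𝓘(ℝ, E) p :=
  ∑ i ∈ ρ.finsupport p, ρ i p • D i σ p

variable {ρ D} {U : ι → Set M}

theorem isCovariantDerivativeOn_glue (hρ : ρ.IsSubordinate U)
    (hD : ∀ i, IsCovariantDerivativeOn (I := 𝓘(ℝ, E)) E (D i) (U i)) :
    IsCovariantDerivativeOn (I := 𝓘(ℝ, E)) E (glue ρ D) where
  add {σ τ p} hσ hτ _ := by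
    rw [glue, glue, glue, ← Finset.sum_add_distrib]
    refine Finset.sum_congr rfl fun i hi ↦ ?_
    rw [(hD i).add hσ hτ (mem_of_mem_finsupport hρ hi), smul_add]
  leibniz {σ g p} hσ hg _ := by
    have h : ∀ i ∈ ρ.finsupport p, ρ i p • D i (g • σ) p =
        g p • ρ i p • D i σ p + ρ i p • (d% g p).smulRight (σ p) := fun i hi ↦ by
      rw [(hD i).leibniz hσ hg (mem_of_mem_finsupport hρ hi), smul_add, smul_comm]
    rw [glue, Finset.sum_congr rfl h, Finset.sum_add_distrib, ← Finset.smul_sum, ← Finset.sum_smul,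
      ρ.sum_finsupport p (mem_univ p), one_smul, glue]

theorem isSmoothEndAt_glue (hρ : ρ.IsSubordinate U) (hU : ∀ i, IsOpen (U i))
    {σ : Π q : M, TangentSpace 𝓘(ℝ, E) q} (hD : ∀ i, ∀ p ∈ U i, IsSmoothEndAt (D i σ) p) (p : M) :
    IsSmoothEndAt (glue ρ D σ) p := by
  have h := ContMDiff.finsum_section_of_locallyFinite (𝕜 := ℝ) (F := E →L[ℝ] E) (n := ∞)
    (I := 𝓘(ℝ, E)) (V := fun q : M ↦ TangentSpace 𝓘(ℝ, E) q →L[ℝ] TangentSpace 𝓘(ℝ, E) q)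
    (t := fun i q ↦ ρ i q • D i σ q)
    (ρ.locallyFinite.subset fun i q hq h0 ↦ hq (by simp [h0])) fun i ↦
      ContMDiffOn.smul_section_of_tsupport (ρ i).contMDiff.contMDiffOn (hU i) (hρ i) fun q hq ↦
        (hD i q hq).contMDiffWithinAt
  simpa only [IsSmoothEndAt, glue, ρ.sum_finsupport_smul_eq_finsum _ fun i _ ↦ D i σ _] using h p

theorem isMetricOn_glue {α : RMetric E M} (hρ : ρ.IsSubordinate U)
    (hD : ∀ i, IsMetricOn α (D i) (U i)) : IsMetricOn α (glue ρ D) univ := by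
  intro p _ Y Z hY hZ v
  have h : ∀ i ∈ ρ.finsupport p, ρ i p * d% (fun q ↦ α.inner q (Y q) (Z q)) p v =
      α.inner p (ρ i p • D i Y p v) (Z p) + α.inner p (Y p) (ρ i p • D i Z p v) := fun i hi ↦ by
    rw [hD i p (mem_of_mem_finsupport hρ hi) Y Z hY hZ v, map_smul, map_smul, smul_apply,
      smul_eq_mul, smul_eq_mul, mul_add]
  calc d% (fun q ↦ α.inner q (Y q) (Z q)) p v
      = ∑ i ∈ ρ.finsupport p, ρ i p * d% (fun q ↦ α.inner q (Y q) (Z q)) p v := by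
        rw [← Finset.sum_mul, ρ.sum_finsupport p (mem_univ p), one_mul]
    _ = α.inner p (glue ρ D Y p v) (Z p) + α.inner p (Y p) (glue ρ D Z p v) := by
        simp only [Finset.sum_congr rfl h, Finset.sum_add_distrib, glue, sum_apply, smul_apply,
          map_sum]

end Glue

theorem contMDiffCovariantDerivative_iff {cov : LinearConnection E M} :
    cov.ContMDiffCovariantDerivative ∞ ↔
      ∀ σ : Π q : M, TangentSpace 𝓘(ℝ, E) q, CMDiff ∞ (T% σ) → ∀ p, IsSmoothEndAt (cov σ) p :=
  ⟨fun h _ hσ ↦ contMDiffOn_univ.1 (h.contMDiff.contMDiff (contMDiffOn_univ.2 hσ)),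
    fun h ↦ ⟨⟨fun hσ ↦ contMDiffOn_univ.2 (h _ (contMDiffOn_univ.1 hσ))⟩⟩⟩

theorem exists_isMetricOn_univ [FiniteDimensional ℝ E] [T2Space M] [SigmaCompactSpace M]
    (α : RMetric E M) :
    ∃ cov : LinearConnection E M, cov.ContMDiffCovariantDerivative ∞ ∧ IsMetricOn α cov univ := by
  obtain ⟨ρ, hρ⟩ := SmoothPartitionOfUnity.exists_isSubordinate_chartAt_source 𝓘(ℝ, E) M
  let cov : LinearConnection E M := ⟨_, isCovariantDerivativeOn_glue hρ fun x₀ ↦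
    isCovariantDerivativeOn_chartConnection x₀ (metricChristoffel α x₀)⟩
  refine ⟨cov, contMDiffCovariantDerivative_iff.2 fun σ hσ ↦ ?_, isMetricOn_glue hρ fun x₀ ↦
    isMetricOn_chartConnection α x₀⟩
  exact isSmoothEndAt_glue hρ (fun x₀ ↦ (chartAt E x₀).open_source) fun x₀ p hp ↦
    isSmoothEndAt_chartConnection hp (contMDiffAt_metricChristoffel α hp) (hσ p)

/-! ### Metric connections with a parallel vector field -/

section Parallel

variable {α : RMetric E M} {b : Π q : M, TangentSpace 𝓘(ℝ, E) q}

theorem inner_cov_self_eq_zero {cov : LinearConnection E M} (hcov : IsMetricOn α cov univ)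
    (hb : MDiffAt (T% b) p)
    (hloc : (fun q ↦ α.inner q (b q) (b q)) =ᶠ[𝓝 p] fun _ ↦ α.inner p (b p) (b p))
    (v : TangentSpace 𝓘(ℝ, E) p) : α.inner p (b p) (cov b p v) = 0 := by
  have h := hcov p (mem_univ p) b b hb hb v
  rw [mvfderiv_congr hloc, mvfderiv_const, α.symm p (cov b p v)] at h
  exact self_eq_neg.1 (by simpa using eq_neg_of_add_eq_zero_left h.symm)

theorem cov_eq_zero_of_apply_eq_zero {cov : LinearConnection E M} (hb : MDiffAt (T% b) p)
    (hloc : (fun q ↦ α.inner q (b q) (b q)) =ᶠ[𝓝 p] fun _ ↦ α.inner p (b p) (b p))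
    (h : b p = 0) : cov b p = 0 := by
  have hb0 : b =ᶠ[𝓝 p] 0 := by
    filter_upwards [hloc] with q hq
    by_contra hne
    simpa [hq, h] using α.pos q (b q) hne
  rw [cov.isCovariantDerivativeOnUniv.congr_of_eventuallyEq (σ' := 0) hb
    (mdifferentiableAt_zeroSection ..) univ_mem hb0, cov.zero, Pi.zero_apply]

variable [FiniteDimensional ℝ E] (α)

theorem metricCoord_coord_sharp (β : Π q : M, TangentSpace 𝓘(ℝ, E) q →L[ℝ] ℝ)
    (hp : p ∈ (chartAt E x₀).source) :
    metricCoord α x₀ p (coord x₀ p (sharp α β p)) = β p ∘L coordSymmL x₀ p := by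
  ext y
  rw [metricCoord_apply α hp, coordField_coord hp, inner_sharp, ContinuousLinearMap.comp_apply,
    coordSymmL_apply hp]

theorem contMDiffAt_sharp {β : Π q : M, TangentSpace 𝓘(ℝ, E) q →L[ℝ] ℝ} (hβ : IsSmoothFormAt β p) :
    CMDiffAt ∞ (T% (sharp α β)) p := by
  have hp := mem_chart_source E p
  have hG : CMDiffAt ∞ (fun q ↦ (metricCoord α p q).inverse) p :=
    (isInvertible_metricCoord α hp).contDiffAt_map_inverse.contMDiffAt.comp p
      (contMDiffAt_metricCoord α hp)
  rw [contMDiffAt_section_iff_coord hp]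
  refine (hG.clm_apply ((isSmoothFormAt_iff_comp_coordSymmL hp).1 hβ)).congr_of_eventuallyEq ?_
  filter_upwards [source_mem_nhds hp] with q hq
  rw [← metricCoord_coord_sharp α β hq, (isInvertible_metricCoord α hq).inverse_apply_self]

/-- The endomorphism-valued form `Y ↦ α(b, b)⁻¹ • (α(B ·, Y) b - α(b, Y) B)`. Adding it to a metric
connection makes `b` parallel if `B` is the covariant derivative of `b` and `α(b, b)` is locally
constant. For `b = 0` it is zero, as `0⁻¹ = 0`. -/
def skewForm {p : M} (b : TangentSpace 𝓘(ℝ, E) p)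
    (B : TangentSpace 𝓘(ℝ, E) p →L[ℝ] TangentSpace 𝓘(ℝ, E) p) :
    TangentSpace 𝓘(ℝ, E) p →L[ℝ] TangentSpace 𝓘(ℝ, E) p →L[ℝ] TangentSpace 𝓘(ℝ, E) p :=
  have : FiniteDimensional ℝ (TangentSpace 𝓘(ℝ, E) p) := inferInstanceAs (FiniteDimensional ℝ E)
  have : T2Space (TangentSpace 𝓘(ℝ, E) p) := inferInstanceAs (T2Space E)
  LinearMap.toContinuousLinearMap
    { toFun Y := (α.inner p b b)⁻¹ • ((α.inner p Y ∘L B).smulRight b - α.inner p b Y • B)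
      map_add' Y Z := by ext; simp; module
      map_smul' a Y := by ext; simp; module }

section skewForm

variable (b : TangentSpace 𝓘(ℝ, E) p)
  (B : TangentSpace 𝓘(ℝ, E) p →L[ℝ] TangentSpace 𝓘(ℝ, E) p) (Y Z v : TangentSpace 𝓘(ℝ, E) p)

theorem skewForm_apply : skewForm α b B Y =
    (α.inner p b b)⁻¹ • ((α.inner p Y ∘L B).smulRight b - α.inner p b Y • B) :=
  rfl

theorem inner_skewForm_add_inner_skewForm :
    α.inner p (skewForm α b B Y v) Z + α.inner p Y (skewForm α b B Z v) = 0 := by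
  simp [skewForm_apply, α.symm p _ Z, α.symm p Y b]
  ring

theorem skewForm_apply_self (h : α.inner p b (B v) = 0) (hb : b = 0 → B v = 0) :
    skewForm α b B b v = -B v := by
  obtain rfl | hne := eq_or_ne b 0
  · simp [skewForm_apply, hb rfl]
  · simp [skewForm_apply, h, smul_smul, (α.pos p b hne).ne']

end skewForm

variable {α}

theorem isSmoothEndAt_skewForm
    {B : Π q : M, TangentSpace 𝓘(ℝ, E) q →L[ℝ] TangentSpace 𝓘(ℝ, E) q}
    {Y : Π q : M, TangentSpace 𝓘(ℝ, E) q} (hb : CMDiffAt ∞ (T% b) p) (hB : IsSmoothEndAt B p)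
    (hY : CMDiffAt ∞ (T% Y) p)
    (hloc : (fun q ↦ α.inner q (b q) (b q)) =ᶠ[𝓝 p] fun _ ↦ α.inner p (b p) (b p)) :
    IsSmoothEndAt (fun q ↦ skewForm α (b q) (B q) (Y q)) p := by
  have hp := mem_chart_source E p
  have hG := contMDiffAt_metricCoord α hp
  rw [contMDiffAt_section_iff_coord hp] at hb hY
  rw [isSmoothEndAt_iff_coordL hp] at hB ⊢
  have hsmulRight := ((contMDiffAt_const (c := ContinuousLinearMap.smulRightL ℝ E E)).clm_apply
    ((hG.clm_apply hY).clm_comp hB)).clm_apply hb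
  have hsmul := ((hG.clm_apply hb).clm_apply hY).smul hB
  refine ((contDiff_const_smul (α.inner p (b p) (b p))⁻¹).contDiffAt.contMDiffAt.comp p
    (hsmulRight.sub hsmul)).congr_of_eventuallyEq ?_
  filter_upwards [source_mem_nhds hp, hloc] with q hq hbq
  ext y
  simp [skewForm_apply, hbq, coordL_apply hq, coord_smul hq, metricCoord_coord_coord α hq]

theorem exists_isMetricOn_univ_and_cov_eq_zero [T2Space M] [SigmaCompactSpace M]
    (hb : CMDiff ∞ (T% b)) (hloc : IsLocallyConstant fun q ↦ α.inner q (b q) (b q)) :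
    ∃ cov : LinearConnection E M, cov.ContMDiffCovariantDerivative ∞ ∧ IsMetricOn α cov univ ∧
      ∀ p, cov b p = 0 := by
  obtain ⟨D, hD, hDα⟩ := exists_isMetricOn_univ α
  rw [contMDiffCovariantDerivative_iff] at hD
  have hb' := fun p ↦ (hb p).mdifferentiableAt (by simp)
  refine ⟨D.addOneForm fun q ↦ skewForm α (b q) (D b q),
    contMDiffCovariantDerivative_iff.2 fun Y hY p ↦ ?_, fun p _ Y Z hY hZ v ↦ ?_, fun p ↦ ?_⟩
  · exact (hD Y hY p).add_section
      (isSmoothEndAt_skewForm (hb p) (hD b hb p) (hY p) (hloc.eventually_eq p))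
  · rw [hDα p (mem_univ p) Y Z hY hZ v]
    have h := inner_skewForm_add_inner_skewForm α (b p) (D b p) (Y p) (Z p) v
    simp only [CovariantDerivative.addOneForm, add_apply, map_add]
    linear_combination -h
  · ext v
    have h := skewForm_apply_self α (b p) (D b p) v
      (inner_cov_self_eq_zero hDα (hb' p) (hloc.eventually_eq p) v) fun h0 ↦ by
        rw [cov_eq_zero_of_apply_eq_zero (hb' p) (hloc.eventually_eq p) h0, zero_apply]
    exact (congrArg (D b p v + ·) h).trans (add_neg_cancel _)

end Parallel

/-! ### Parallel vector fields along curves -/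

theorem eq_of_hasDerivWithinAt_zero {G : Type*} [NormedAddCommGroup G] [NormedSpace ℝ G]
    {f : ℝ → G} {a b : ℝ} (hab : a ≤ b)
    (h : ∀ t ∈ Icc a b, HasDerivWithinAt f 0 (Icc a b) t) : f b = f a :=
  constant_of_derivWithin_zero (fun t ht ↦ (h t ht).differentiableWithinAt)
    (fun t ht ↦ (h t (Ico_subset_Icc_self ht)).derivWithin
      (uniqueDiffOn_Icc (ht.1.trans_lt ht.2) t (Ico_subset_Icc_self ht)))
    b (right_mem_Icc.2 hab)

theorem eventually_curve_mem_source {E : Type*} [TopologicalSpace E] {M : Type*}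
    [TopologicalSpace M] [ChartedSpace E M] {x₀ : M} {c : ℝ → M} {s : Set ℝ} {t : ℝ}
    (hc : ContinuousWithinAt c s t) (ht : c t ∈ (chartAt E x₀).source) :
    ∀ᶠ r in 𝓝[s] t, c r ∈ (chartAt E x₀).source :=
  hc.eventually (source_mem_nhds ht)

variable {c : ℝ → M} {t : ℝ} {X Y : Π s : ℝ, TangentSpace 𝓘(ℝ, E) (c s)}

theorem isParallelAlong_iff [FiniteDimensional ℝ E] {cov : LinearConnection E M} :
    IsParallelAlong cov c X ↔ ∀ x₀ : M, ∀ t ∈ Icc (0 : ℝ) 1, c t ∈ (chartAt E x₀).source →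
      HasDerivWithinAt (fun s ↦ coord x₀ (c s) (X s))
        (-christoffel cov x₀ (c t) (coord x₀ (c t) (velocity c t)) (coord x₀ (c t) (X t)))
        (Icc 0 1) t :=
  forall₄_congr fun x₀ t _ hp ↦ by rw [coord_cov_coordField cov hp]

theorem IsParallelAlong.neg [FiniteDimensional ℝ E] {cov : LinearConnection E M}
    (hc : ContinuousOn c (Icc 0 1)) (hX : IsParallelAlong cov c X) :
    IsParallelAlong cov c fun t ↦ -X t := by
  rw [isParallelAlong_iff] at hX ⊢
  intro x₀ t ht hp
  refine ((hX x₀ t ht hp).neg.congr_of_eventuallyEq ?_ (coord_neg hp _)).congr_deriv ?_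
  · filter_upwards [eventually_curve_mem_source (hc t ht) hp] with s hs using coord_neg hs _
  · rw [coord_neg hp, ContinuousLinearMap.map_neg]

theorem hasDerivWithinAt_inner_curve (α : RMetric E M) {x' y' : E}
    (hc : MDifferentiableWithinAt 𝓘(ℝ, ℝ) 𝓘(ℝ, E) c (Icc 0 1) t)
    (hp : c t ∈ (chartAt E x₀).source)
    (hX : HasDerivWithinAt (fun s ↦ coord x₀ (c s) (X s)) x' (Icc 0 1) t)
    (hY : HasDerivWithinAt (fun s ↦ coord x₀ (c s) (Y s)) y' (Icc 0 1) t) :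
    HasDerivWithinAt (fun s ↦ α.inner (c s) (X s) (Y s))
      (d% (metricCoord α x₀) (c t) (velocity c t) (coord x₀ (c t) (X t)) (coord x₀ (c t) (Y t)) +
        metricCoord α x₀ (c t) x' (coord x₀ (c t) (Y t)) +
        metricCoord α x₀ (c t) (coord x₀ (c t) (X t)) y') (Icc 0 1) t := by
  have hG := hasDerivWithinAt_comp_curve (mdifferentiableAt_metricCoord α hp) hc
  refine ((hG.clm_apply hX).clm_apply hY).congr_of_eventuallyEq ?_
    (metricCoord_coord_coord α hp _ _).symm
  filter_upwards [eventually_curve_mem_source hc.continuousWithinAt hp] with s hs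
    using (metricCoord_coord_coord α hs _ _).symm

theorem IsParallelAlong.inner_eq {cov : LinearConnection E M} {α : RMetric E M}
    (hcov : IsMetricOn α cov univ) (hc : MDifferentiableOn 𝓘(ℝ, ℝ) 𝓘(ℝ, E) c (Icc 0 1))
    (hX : IsParallelAlong cov c X) (hY : IsParallelAlong cov c Y) :
    α.inner (c 1) (X 1) (Y 1) = α.inner (c 0) (X 0) (Y 0) := by
  refine eq_of_hasDerivWithinAt_zero (f := fun t ↦ α.inner (c t) (X t) (Y t)) zero_le_one
    fun t ht ↦ ?_
  have hp := mem_chart_source E (c t)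
  refine (hasDerivWithinAt_inner_curve α (hc t ht) hp (hX _ t ht hp)
    (hY _ t ht hp)).congr_deriv ?_
  have hσ := mdifferentiableAt_coordField hp (coord (c t) (c t) (X t))
  have hτ := mdifferentiableAt_coordField hp (coord (c t) (c t) (Y t))
  have h := hcov (c t) (mem_univ _) _ _ hσ hτ (velocity c t)
  rw [mvfderiv_inner α hp hσ hτ, mvfderiv_congr (eventually_coord_coordField hp _),
    mvfderiv_congr (eventually_coord_coordField hp _), mvfderiv_const, mvfderiv_const,
    ← metricCoord_coord_coord α hp, ← metricCoord_coord_coord α hp, coord_coordField hp,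
    coord_coordField hp] at h
  simp only [zero_apply, map_zero, add_zero] at h
  rw [h, ContinuousLinearMap.map_neg₂, ContinuousLinearMap.map_neg]
  ring

theorem isParallelAlong_of_cov_eq_zero [FiniteDimensional ℝ E] {cov : LinearConnection E M}
    {b : Π p : M, TangentSpace 𝓘(ℝ, E) p} (hb : MDiff (T% b)) (hcov : ∀ p, cov b p = 0)
    (hc : MDifferentiableOn 𝓘(ℝ, ℝ) 𝓘(ℝ, E) c (Icc 0 1)) :
    IsParallelAlong cov c (fun t ↦ b (c t)) := by
  refine isParallelAlong_iff.2 fun x₀ t ht hp ↦ (hasDerivWithinAt_comp_curve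
    ((mdifferentiableAt_section_iff_coord hp).1 (hb (c t))) (hc t ht)).congr_deriv
      (eq_neg_of_add_eq_zero_left ?_)
  rw [← coord_cov cov hp (hb (c t)), hcov, zero_apply, ← coordL_apply hp, map_zero]

theorem coordL_comp_coordSymmL_apply {x₁ : M} (h₀ : p ∈ (chartAt E x₀).source)
    (h₁ : p ∈ (chartAt E x₁).source) (y : E) :
    (coordL x₁ p ∘L coordSymmL x₀ p) y = coord x₁ p (coordField x₀ y p) := by
  rw [ContinuousLinearMap.comp_apply, coordSymmL_apply h₀, coordL_apply h₁]

theorem mdifferentiableAt_coordL_comp_coordSymmL {x₁ : M} (h₀ : p ∈ (chartAt E x₀).source)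
    (h₁ : p ∈ (chartAt E x₁).source) :
    MDiffAt (fun q ↦ coordL x₁ q ∘L coordSymmL (E := E) x₀ q) p := by
  have h : IsSmoothFormAt (coordL (E := E) x₁) p := by
    refine (isSmoothFormAt_iff_comp_coordSymmL h₁).2 <|
      (contMDiffAt_const (c := ContinuousLinearMap.id ℝ E)).congr_of_eventuallyEq ?_
    filter_upwards [source_mem_nhds h₁] with q hq
    ext y
    rw [coordL_comp_coordSymmL_apply hq hq, coord_coordField hq,
      ContinuousLinearMap.id_apply]
  exact ((isSmoothFormAt_iff_comp_coordSymmL h₀).1 h).mdifferentiableAt (by simp)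

theorem hasDerivWithinAt_coord_of_hasDerivWithinAt_coord [FiniteDimensional ℝ E]
    (cov : LinearConnection E M) {x₁ : M}
    (hc : MDifferentiableWithinAt 𝓘(ℝ, ℝ) 𝓘(ℝ, E) c (Icc 0 1) t)
    (h₀ : c t ∈ (chartAt E x₀).source) (h₁ : c t ∈ (chartAt E x₁).source)
    (hX : HasDerivWithinAt (fun s ↦ coord x₀ (c s) (X s))
      (-christoffel cov x₀ (c t) (coord x₀ (c t) (velocity c t)) (coord x₀ (c t) (X t)))
      (Icc 0 1) t) :
    HasDerivWithinAt (fun s ↦ coord x₁ (c s) (X s))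
      (-christoffel cov x₁ (c t) (coord x₁ (c t) (velocity c t)) (coord x₁ (c t) (X t)))
      (Icc 0 1) t := by
  have hcoord : ∀ q ∈ (chartAt E x₀).source, q ∈ (chartAt E x₁).source → ∀ v,
      coord x₁ q v = (coordL x₁ q ∘L coordSymmL x₀ q) (coord (E := E) x₀ q v) :=
    fun q hq₀ hq₁ v ↦ by rw [coordL_comp_coordSymmL_apply hq₀ hq₁, coordField_coord hq₀]
  refine ((hasDerivWithinAt_clm_apply_comp_curve
    (mdifferentiableAt_coordL_comp_coordSymmL h₀ h₁) hc hX).congr_of_eventuallyEq ?_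
      (hcoord _ h₀ h₁ _)).congr_deriv ?_
  · filter_upwards [eventually_curve_mem_source hc.continuousWithinAt h₀,
      eventually_curve_mem_source hc.continuousWithinAt h₁] with s hs₀ hs₁
      using hcoord _ hs₀ hs₁ _
  have hσ : (fun q ↦ (coordL x₁ q ∘L coordSymmL x₀ q) (coord x₀ (c t) (X t))) =ᶠ[𝓝 (c t)]
      fun q ↦ coord x₁ q (coordField x₀ (coord x₀ (c t) (X t)) q) := by
    filter_upwards [source_mem_nhds h₀, source_mem_nhds h₁] with q hq₀ hq₁
      using coordL_comp_coordSymmL_apply hq₀ hq₁ _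
  have h := coord_cov cov h₁ (mdifferentiableAt_coordField h₀ (coord x₀ (c t) (X t)))
    (velocity c t)
  rw [coordField_coord h₀, ← sub_eq_iff_eq_add] at h
  rw [mvfderiv_congr hσ, ← h, ContinuousLinearMap.map_neg, ← coord_cov_coordField cov h₀,
    ← hcoord _ h₀ h₁]
  abel

/-! ### Existence of parallel vector fields -/

theorem isSmoothEndAt_cov [FiniteDimensional ℝ E] [T2Space M] {cov : LinearConnection E M}
    (hcov : cov.ContMDiffCovariantDerivative ∞) {σ : Π q : M, TangentSpace 𝓘(ℝ, E) q} {U : Set M}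
    (hU : IsOpen U) (hσ : ∀ q ∈ U, CMDiffAt ∞ (T% σ) q) (hp : p ∈ U) :
    IsSmoothEndAt (cov σ) p := by
  -- Smoothness of `cov` only speaks about global vector fields, so cut `σ` off outside `U`.
  obtain ⟨χ, -, hχ⟩ := (SmoothBumpFunction.nhds_basis_tsupport (I := 𝓘(ℝ, E)) p).mem_iff.1
    (hU.mem_nhds hp)
  have hχσ : CMDiff ∞ (T% ((χ : M → ℝ) • σ)) :=
    ContMDiffOn.smul_section_of_tsupport χ.contMDiff.contMDiffOn hU hχ fun q hq ↦
      (hσ q hq).contMDiffWithinAt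
  refine (contMDiffCovariantDerivative_iff.1 hcov _ hχσ p).congr_of_eventuallyEq ?_
  filter_upwards [χ.eventuallyEq_one.eventuallyEq_nhds, hU.mem_nhds hp] with q hq hqU
  congr 1
  refine cov.isCovariantDerivativeOnUniv.congr_of_eventuallyEq
    ((hσ q hqU).mdifferentiableAt (by simp)) (hχσ.mdifferentiable (by simp) q) univ_mem ?_
  filter_upwards [hq] with r hr
  simp [hr]

theorem exists_hasDerivWithinAt_linear {G : Type*} [NormedAddCommGroup G] [NormedSpace ℝ G]
    [CompleteSpace G] {A : ℝ → G →L[ℝ] G} (hA : ContinuousOn A (Icc 0 1))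
    (hA' : ∀ t ∈ Icc (0 : ℝ) 1, ‖A t‖ ≤ 1 / 2) (x : G) :
    ∃ f : ℝ → G, f 0 = x ∧ ∀ t ∈ Icc (0 : ℝ) 1, HasDerivWithinAt f (A t (f t)) (Icc 0 1) t := by
  -- On the ball of radius `‖x‖` around `x` the speed is at most `‖x‖`, so up to time `1` the
  -- solution cannot leave it.
  have h : IsPicardLindelof (fun t y ↦ A t y) (tmin := 0) (tmax := 1)
      ⟨0, left_mem_Icc.2 zero_le_one⟩ x ‖x‖₊ 0 ‖x‖₊ (1 / 2) :=
    { lipschitzOnWith := fun t ht ↦ by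
        refine ((A t).lipschitz.weaken ?_).lipschitzOnWith
        exact_mod_cast hA' t ht
      continuousOn := fun y _ ↦ hA.clm_apply continuousOn_const
      norm_le := fun t ht y hy ↦ by
        have hy' : ‖y‖ ≤ 2 * ‖x‖ := by
          have hyx : ‖y - x‖ ≤ ‖x‖ := by simpa [dist_eq_norm] using hy
          linarith [norm_le_norm_add_norm_sub' y x]
        calc ‖A t y‖ ≤ ‖A t‖ * ‖y‖ := (A t).le_opNorm y
          _ ≤ 1 / 2 * (2 * ‖x‖) := by gcongr; exact hA' t ht
          _ = ‖x‖₊ := by simp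
      mul_max_le := by simp }
  exact h.exists_eq_forall_mem_Icc_hasDerivWithinAt₀

/-- The curve from `p` to `q` which is a line segment in the chart at `x₀`. -/
def segmentCurve (x₀ p q : M) (t : ℝ) : M :=
  (chartAt E x₀).symm (AffineMap.lineMap (chartAt E x₀ p) (chartAt E x₀ q) t)

theorem mapsTo_segmentCurve {E : Type*} [NormedAddCommGroup E] [NormedSpace ℝ E] {M : Type*}
    [TopologicalSpace M] [ChartedSpace E M] {x₀ p q : M}
    (hpq : segment ℝ (chartAt E x₀ p) (chartAt E x₀ q) ⊆ (chartAt E x₀).target) :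
    MapsTo (segmentCurve (E := E) x₀ p q) (Icc 0 1) (chartAt E x₀).source := fun _ ht ↦
  (chartAt E x₀).map_target (hpq (lineMap_mem_segment ℝ _ _ ht))

theorem mvfderiv_chartAt (hp : p ∈ (chartAt E x₀).source) (v : TangentSpace 𝓘(ℝ, E) p) :
    d% (chartAt E x₀) p v = coord x₀ p v := by
  have : IsManifold 𝓘(ℝ, E) 1 M := IsManifold.of_le (n := ∞) (by simp)
  rw [← coordL_apply hp, coordL, TangentBundle.continuousLinearMapAt_trivializationAt hp]
  rfl

theorem contMDiffOn_segmentCurve {q : M}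
    (hpq : segment ℝ (chartAt E x₀ p) (chartAt E x₀ q) ⊆ (chartAt E x₀).target) :
    ContMDiffOn 𝓘(ℝ, ℝ) 𝓘(ℝ, E) ∞ (segmentCurve (E := E) x₀ p q) (Icc 0 1) := by
  have h : ContDiff ℝ ∞ (AffineMap.lineMap (k := ℝ) (chartAt E x₀ p) (chartAt E x₀ q)) := by
    simpa only [AffineMap.lineMap_apply_module', Function.comp_def] using by fun_prop
  exact (contMDiffOn_chart_symm (I := 𝓘(ℝ, E)) (x := x₀) (n := ∞)).comp h.contMDiff.contMDiffOn
    fun _ ht ↦ hpq (lineMap_mem_segment ℝ _ _ ht)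

theorem coord_velocity_segmentCurve {q : M}
    (hpq : segment ℝ (chartAt E x₀ p) (chartAt E x₀ q) ⊆ (chartAt E x₀).target)
    {t : ℝ} (ht : t ∈ Icc (0 : ℝ) 1) :
    coord x₀ (segmentCurve (E := E) x₀ p q t) (velocity (segmentCurve (E := E) x₀ p q) t) =
      chartAt E x₀ q - chartAt E x₀ p := by
  have hs := mapsTo_segmentCurve hpq ht
  have hφ : MDiffAt (chartAt E x₀) (segmentCurve (E := E) x₀ p q t) :=
    ((contMDiffOn_chart (I := 𝓘(ℝ, E)) (x := x₀) (n := ∞)).contMDiffAt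
      (source_mem_nhds hs)).mdifferentiableAt (by simp)
  have hcoord := hasDerivWithinAt_comp_curve hφ
    ((contMDiffOn_segmentCurve hpq t ht).mdifferentiableWithinAt (by simp))
  have hline := AffineMap.hasDerivWithinAt_lineMap (𝕜 := ℝ) (a := chartAt E x₀ p)
    (b := chartAt E x₀ q) (s := Icc 0 1) (x := t)
  have hright : ∀ s ∈ Icc (0 : ℝ) 1, chartAt E x₀ (segmentCurve (E := E) x₀ p q s) =
      AffineMap.lineMap (chartAt E x₀ p) (chartAt E x₀ q) s := fun s hs ↦
    (chartAt E x₀).right_inv (hpq (lineMap_mem_segment ℝ _ _ hs))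
  rw [← mvfderiv_chartAt hs]
  exact (uniqueDiffOn_Icc zero_lt_one t ht).eq_deriv _ hcoord (hline.congr hright (hright t ht))

variable [FiniteDimensional ℝ E]

theorem continuousOn_christoffel [T2Space M] {cov : LinearConnection E M}
    (hcov : cov.ContMDiffCovariantDerivative ∞) (x₀ : M) :
    ContinuousOn (christoffel cov x₀) (chartAt E x₀).source := by
  refine continuousOn_clm_apply.2 fun u ↦ continuousOn_clm_apply.2 fun y p hp ↦ ?_
  have h : IsSmoothEndAt (cov (coordField x₀ y)) p :=
    isSmoothEndAt_cov hcov (chartAt E x₀).open_source (fun q hq ↦ contMDiffAt_coordField hq y) hp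
  have heq : ∀ q ∈ (chartAt E x₀).source, christoffel cov x₀ q u y =
      (coordL x₀ q ∘L cov (coordField x₀ y) q ∘L coordSymmL x₀ q) u := fun q hq ↦ by
    rw [ContinuousLinearMap.comp_apply, ContinuousLinearMap.comp_apply, coordL_apply hq,
      coordSymmL_apply hq, coord_cov_coordField cov hq, coord_coordField hq]
  exact (((isSmoothEndAt_iff_coordL hp).1 h).continuousAt.clm_apply
    (continuousAt_const (y := u))).continuousWithinAt.congr heq (heq p hp)

theorem exists_isParallelAlong [T2Space M] {cov : LinearConnection E M}
    (hcov : cov.ContMDiffCovariantDerivative ∞) {u : E}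
    (hc : MDifferentiableOn 𝓘(ℝ, ℝ) 𝓘(ℝ, E) c (Icc 0 1))
    (hsource : MapsTo c (Icc 0 1) (chartAt E x₀).source)
    (hvel : ∀ t ∈ Icc (0 : ℝ) 1, coord x₀ (c t) (velocity c t) = u)
    (hu : ∀ t ∈ Icc (0 : ℝ) 1, ‖christoffel cov x₀ (c t) u‖ ≤ 1 / 2)
    (v : TangentSpace 𝓘(ℝ, E) (c 0)) :
    ∃ X : Π t : ℝ, TangentSpace 𝓘(ℝ, E) (c t), IsParallelAlong cov c X ∧ X 0 = v := by
  have hA : ContinuousOn (fun t ↦ -christoffel cov x₀ (c t) u) (Icc 0 1) :=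
    (((continuousOn_christoffel hcov x₀).comp hc.continuousOn hsource).clm_apply
      continuousOn_const).neg
  obtain ⟨f, hf0, hf⟩ := exists_hasDerivWithinAt_linear hA
    (fun t ht ↦ (norm_neg _).trans_le (hu t ht)) (coord x₀ (c 0) v)
  have hcoord : ∀ t ∈ Icc (0 : ℝ) 1, coord x₀ (c t) (coordField x₀ (f t) (c t)) = f t :=
    fun t ht ↦ coord_coordField (hsource ht) (f t)
  refine ⟨fun t ↦ coordField x₀ (f t) (c t), isParallelAlong_iff.2 fun x₁ t ht hx₁ ↦ ?_, ?_⟩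
  · refine hasDerivWithinAt_coord_of_hasDerivWithinAt_coord cov (hc t ht) (hsource ht) hx₁ ?_
    rw [hcoord t ht, hvel t ht]
    exact (hf t ht).congr hcoord (hcoord t ht)
  · simp only [hf0]
    exact coordField_coord (hsource (left_mem_Icc.2 zero_le_one)) v

theorem exists_forall_mem_ball_norm_christoffel_le [T2Space M] {cov : LinearConnection E M}
    (hcov : cov.ContMDiffCovariantDerivative ∞) (x₀ : M) :
    ∃ ε > 0, ∀ z ∈ Metric.ball (chartAt E x₀ x₀) ε, z ∈ (chartAt E x₀).target ∧
      ∀ u ∈ Metric.ball (0 : E) ε, ‖christoffel cov x₀ ((chartAt E x₀).symm z) u‖ ≤ 1 / 2 := by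
  have hx₀ := mem_chart_target E x₀
  have hΓ : ContinuousAt (fun z : E ↦ christoffel cov x₀ ((chartAt E x₀).symm z))
      (chartAt E x₀ x₀) :=
    ((continuousOn_christoffel hcov x₀).continuousAt (source_mem_nhds
      ((chartAt E x₀).map_target hx₀))).comp ((chartAt E x₀).continuousAt_symm hx₀)
  have hcont : ContinuousAt (fun z : E × E ↦ ‖christoffel cov x₀ ((chartAt E x₀).symm z.1) z.2‖)
      (chartAt E x₀ x₀, 0) :=
    ((hΓ.comp (x := (chartAt E x₀ x₀, (0 : E))) continuousAt_fst).clm_apply continuousAt_snd).norm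
  obtain ⟨ε, hε, h⟩ := Metric.eventually_nhds_iff_ball.1
    ((hcont.eventually_lt (continuousAt_const (y := 1 / 2)) (by simp)).and
      (continuousAt_fst.eventually ((chartAt E x₀).open_target.mem_nhds hx₀)))
  simp only [← ball_prod_same, mem_prod, and_imp, Prod.forall] at h
  exact ⟨ε, hε, fun z hz ↦ ⟨(h z 0 hz (Metric.mem_ball_self hε)).2, fun u hu ↦ (h z u hz hu).1.le⟩⟩

theorem exists_mem_nhds_isParallelAlong [T2Space M] {cov : LinearConnection E M}
    (hcov : cov.ContMDiffCovariantDerivative ∞) (x₀ : M) :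
    ∃ U ∈ 𝓝 x₀, ∀ p ∈ U, ∀ q ∈ U, ∃ c : ℝ → M, ContMDiffOn 𝓘(ℝ, ℝ) 𝓘(ℝ, E) ∞ c (Icc 0 1) ∧
      c 0 = p ∧ c 1 = q ∧ ∀ v : TangentSpace 𝓘(ℝ, E) (c 0),
        ∃ X : Π t : ℝ, TangentSpace 𝓘(ℝ, E) (c t), IsParallelAlong cov c X ∧ X 0 = v := by
  obtain ⟨ε, hε, hball⟩ := exists_forall_mem_ball_norm_christoffel_le hcov x₀
  have hx₀ := mem_chart_source E x₀
  refine ⟨(chartAt E x₀).source ∩ chartAt E x₀ ⁻¹' Metric.ball (chartAt E x₀ x₀) (ε / 2),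
    inter_mem (source_mem_nhds hx₀) (((chartAt E x₀).continuousAt hx₀).preimage_mem_nhds
      (Metric.ball_mem_nhds _ (half_pos hε))), ?_⟩
  rintro p ⟨hp, hpε⟩ q ⟨hq, hqε⟩
  have hseg : segment ℝ (chartAt E x₀ p) (chartAt E x₀ q) ⊆ Metric.ball (chartAt E x₀ x₀) ε :=
    ((convex_ball _ _).segment_subset hpε hqε).trans (Metric.ball_subset_ball (half_le_self hε.le))
  have htarget := hseg.trans fun z hz ↦ (hball z hz).1
  have hsub : chartAt E x₀ q - chartAt E x₀ p ∈ Metric.ball (0 : E) ε := by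
    rw [mem_ball_zero_iff, ← dist_eq_norm]
    exact (dist_triangle_right _ _ _).trans_lt ((add_lt_add hqε hpε).trans_eq (add_halves ε))
  have hc := contMDiffOn_segmentCurve htarget
  refine ⟨segmentCurve (E := E) x₀ p q, hc, by simp [segmentCurve, hp], by simp [segmentCurve, hq],
    exists_isParallelAlong hcov (hc.mdifferentiableOn (by simp)) (mapsTo_segmentCurve htarget)
      (fun t ht ↦ coord_velocity_segmentCurve htarget ht) fun t ht ↦ ?_⟩
  exact (hball _ (hseg (lineMap_mem_segment ℝ _ _ ht))).2 _ hsub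

/-! ### Randers metrics -/

variable {F : TangentBundle 𝓘(ℝ, E) M → ℝ} {α : RMetric E M}
  {β : Π p : M, TangentSpace 𝓘(ℝ, E) p →L[ℝ] ℝ}

theorem length_sharp_le {cov : LinearConnection E M}
    (hF : ∀ p v, F ⟨p, v⟩ = length α p v + β p v) (hcov : IsCompatible cov F)
    (hc : ContMDiffOn 𝓘(ℝ, ℝ) 𝓘(ℝ, E) ∞ c (Icc 0 1)) (hX : IsParallelAlong cov c X)
    (hX0 : X 0 = sharp α β (c 0)) :
    length α (c 0) (sharp α β (c 0)) ≤ length α (c 1) (sharp α β (c 1)) := by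
  -- Transporting both `β^♯` and `-β^♯` shows that `√α` and `β` are preserved separately.
  have hpos := hcov c hc _ _ ⟨X, hX, hX0, rfl⟩
  have hneg := hcov c hc _ _ ⟨_, hX.neg hc.continuousOn, congrArg _ hX0, rfl⟩
  simp only [hF, length_neg, ContinuousLinearMap.map_neg] at hpos hneg
  have hlength : length α (c 1) (X 1) = length α (c 0) (sharp α β (c 0)) := by linarith
  have hβ : β (c 1) (X 1) = β (c 0) (sharp α β (c 0)) := by linarith
  have h := inner_le_length_mul_length α (sharp α β (c 1)) (X 1)
  rw [inner_sharp, hβ, hlength, ← inner_sharp α β, ← sq_length, sq] at h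
  obtain h0 | h0 := (Real.sqrt_nonneg _ : 0 ≤ length α (c 0) (sharp α β (c 0))).eq_or_lt
  · exact h0.symm.trans_le (Real.sqrt_nonneg _)
  · exact le_of_mul_le_mul_right h h0

theorem IsGeneralizedBerwald.isLocallyConstant_length_sharp [T2Space M]
    (hF : ∀ p v, F ⟨p, v⟩ = length α p v + β p v) (h : IsGeneralizedBerwald F) :
    IsLocallyConstant fun p ↦ length α p (sharp α β p) := by
  obtain ⟨cov, hcov, hcompat⟩ := h
  refine (IsLocallyConstant.iff_eventually_eq _).2 fun x₀ ↦ ?_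
  obtain ⟨U, hU, hpar⟩ := exists_mem_nhds_isParallelAlong hcov x₀
  have hle : ∀ p ∈ U, ∀ q ∈ U, length α p (sharp α β p) ≤ length α q (sharp α β q) := by
    intro p hp q hq
    obtain ⟨c, hc, rfl, rfl, hX⟩ := hpar p hp q hq
    obtain ⟨X, hX, hX0⟩ := hX (sharp α β (c 0))
    exact length_sharp_le hF hcompat hc hX hX0
  filter_upwards [hU] with p hp
  exact (hle p hp x₀ (mem_of_mem_nhds hU)).antisymm (hle x₀ (mem_of_mem_nhds hU) p hp)

theorem isCompatible_of_cov_sharp_eq_zero {cov : LinearConnection E M}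
    (hF : ∀ p v, F ⟨p, v⟩ = length α p v + β p v) (hcov : IsMetricOn α cov univ)
    (hsharp : MDiff (T% (sharp α β))) (hcov' : ∀ p, cov (sharp α β) p = 0) :
    IsCompatible cov F := by
  rintro c hc _ _ ⟨X, hX, rfl, rfl⟩
  have hc' := hc.mdifferentiableOn (by simp)
  have hβ := (isParallelAlong_of_cov_eq_zero hsharp hcov' hc').inner_eq hcov hc' hX
  rw [inner_sharp, inner_sharp] at hβ
  rw [hF, hF, hβ, length, length, hX.inner_eq hcov hc' hX]

theorem isGeneralizedBerwald_of_isLocallyConstant [T2Space M] [SigmaCompactSpace M]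
    (hβ : IsSmoothOneForm β) (hF : ∀ p v, F ⟨p, v⟩ = length α p v + β p v)
    (h : IsLocallyConstant fun p ↦ length α p (sharp α β p)) : IsGeneralizedBerwald F := by
  have hsharp : CMDiff ∞ (T% (sharp α β)) := fun p ↦ contMDiffAt_sharp α (hβ p)
  have hinner : IsLocallyConstant fun p ↦ α.inner p (sharp α β p) (sharp α β p) :=
    (funext fun p ↦ sq_length α (sharp α β p)) ▸ h.comp fun x ↦ x ^ 2
  obtain ⟨cov, hcov, hmetric, hzero⟩ := exists_isMetricOn_univ_and_cov_eq_zero hsharp hinner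
  exact ⟨cov, hcov, isCompatible_of_cov_sharp_eq_zero hF hmetric
    (hsharp.mdifferentiable (by simp)) hzero⟩

theorem isRiemannian_of_length_sharp_eq_zero (hF : ∀ p v, F ⟨p, v⟩ = length α p v + β p v)
    (h : ∀ p, length α p (sharp α β p) = 0) : IsRiemannian F := by
  refine ⟨α, fun p v ↦ ?_⟩
  have h0 : sharp α β p = 0 := by
    by_contra hne
    exact (Real.sqrt_pos.2 (α.pos p _ hne)).ne' (h p)
  rw [hF, ← inner_sharp α β, h0, map_zero, zero_apply, add_zero]

theorem isLocallyConstant_length_sharp_iff [ConnectedSpace M]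
    (hF : ∀ p v, F ⟨p, v⟩ = length α p v + β p v) (hnR : ¬IsRiemannian F) :
    IsLocallyConstant (fun p ↦ length α p (sharp α β p)) ↔
      ∃ K : ℝ, 0 < K ∧ ∀ p, length α p (sharp α β p) = K := by
  refine ⟨fun h ↦ ?_, fun ⟨K, _, hK⟩ ↦ by simpa only [hK] using .const K⟩
  obtain ⟨K, hK⟩ := h.exists_eq_const
  replace hK := congrFun hK
  have hK0 : K ≠ 0 := by
    rintro rfl
    exact hnR (isRiemannian_of_length_sharp_eq_zero hF hK)
  obtain ⟨p⟩ := ‹ConnectedSpace M›.toNonempty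
  exact ⟨K, ((Real.sqrt_nonneg _).trans_eq (hK p)).lt_of_ne' hK0, hK⟩

end Randers
end

theorem proposition4_general {E : Type*} [NormedAddCommGroup E] [NormedSpace ℝ E]
    [FiniteDimensional ℝ E] {M : Type*} [TopologicalSpace M] [ChartedSpace E M]
    [IsManifold 𝓘(ℝ, E) ∞ M] [T2Space M] [SigmaCompactSpace M]
    {F : TangentBundle 𝓘(ℝ, E) M → ℝ} {α : Randers.RMetric E M}
    {β : Π p : M, TangentSpace 𝓘(ℝ, E) p →L[ℝ] ℝ} (hβ : Randers.IsSmoothOneForm β)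
    (hF : ∀ p v, F ⟨p, v⟩ = Randers.length α p v + β p v) :
    Randers.IsGeneralizedBerwald F ↔
      IsLocallyConstant fun p ↦ Randers.length α p (Randers.sharp α β p) :=
  ⟨Randers.IsGeneralizedBerwald.isLocallyConstant_length_sharp hF,
    Randers.isGeneralizedBerwald_of_isLocallyConstant hβ hF⟩

theorem proposition4 {E : Type*} [NormedAddCommGroup E] [NormedSpace ℝ E] [FiniteDimensional ℝ E]
    {M : Type*} [TopologicalSpace M] [ChartedSpace E M] [IsManifold 𝓘(ℝ, E) ∞ M]
    [T2Space M] [SecondCountableTopology M] [ConnectedSpace M]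
    (F : TangentBundle 𝓘(ℝ, E) M → ℝ) (α : Randers.RMetric E M)
    (β : Π p : M, TangentSpace 𝓘(ℝ, E) p →L[ℝ] ℝ)
    (hF : Randers.IsRandersMetric F α β) (hnR : ¬ Randers.IsRiemannian F) :
    Randers.IsGeneralizedBerwald F ↔
      ∃ K : ℝ, 0 < K ∧ ∀ p : M, Randers.length α p (Randers.sharp α β p) = K := by
  have : LocallyCompactSpace M := ChartedSpace.locallyCompactSpace E M
  exact (proposition4_general hF.smooth_form hF.eq_add).trans
    (Randers.isLocallyConstant_length_sharp_iff hF.eq_add hnR)
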